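/- A Hadamard space is a complete metric space $(X,d)$ in which any two points $x,y$ have a midpoint $m$ with $d(z,m)^2\le\frac12 d(z,x)^2+\frac12 d(z,y)^2-\frac14 d(x,y)^2$ for all $z\in X$. For $x,y\in X$ and $\lambda\in[0,1]$, let $\gamma_{x,y}(\lambda)$ be the unique point $p$ with $d(z,p)^2\le(1-\lambda)d(z,x)^2+\lambda d(z,y)^2-\lambda(1-\lambda)d(x,y)^2$ for all $z\in X$, and let $[x,y]=\{\gamma_{x,y}(\lambda):\lambda\in[0,1]\}$. A function $h:X\to[-\infty,+\infty]$ is proper if it is not identically $+\infty$ and never $-\infty$; convex if $h(\gamma_{x,y}(\lambda))\le(1-\lambda)h(x)+\lambda h(y)$ for all $x,y\in X$, $\lambda\in[0,1]$; uniformly convex if there is a nondecreasing $\phi:[0,\infty)\to[0,+\infty]$ with $\phi(t)=0\iff t=0$ and $h(\gamma_{x,y}(\lambda))+\lambda(1-\lambda)\phi(d(x,y))\le(1-\lambda)h(x)+\lambda h(y)$ for all $x,y\in X$, $\lambda\in[0,1]$ (with $0\cdot\infty=0$). For $h$ proper, convex and lower semicontinuous, $\mathrm{Prox}_h(x)$ is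 the unique minimizer of $y\mapsto h(y)+\frac12 d(x,y)^2$. A sequence $(u_n)$ in a Hadamard space converges weakly ($\Delta$-converges) to $u$ if for every point $w$ the metric projections (nearest points) of $u_n$ onto $[u,w]$ converge to $u$. The product $X^2=X\times X$ is a Hadamard space with the metric $d((x_1,y_1),(x_2,y_2))^2=d(x_1,x_2)^2+d(y_1,y_2)^2$. **Theorem.** Let $X$ be a Hadamard space, let $f,g:X\to[-\infty,+\infty]$ be proper, convex and lower semicontinuous, let $\gamma>0$, and suppose that $\Phi(x,y)=f(x)+g(y)+\frac1{2\gamma}d(x,y)^2$ is bounded below on $X^2$. Let $(x_n)_{n\ge0}$ and $(y_n)_{n\ge0}$ be sequences in $X$ with $$\sum_{n=0}^\infty d(y_n,\mathrm{Prox}_{\gamma g}(x_n))<\infty\quad\text{and}\quad\sum_{n=0}^\infty d(x_{n+1},\mathrm{Prox}_{\gamma f}(y_n))<\infty.$$ Then: (a) $\sum_{n=0}^\infty d(x_{n+1},x_n)^2<\infty$ and $\sum_{n=0}^\infty d(y_{n+1},y_n)^2<\infty$. If, moreover, $\Phi$ has a minimizer over $X^2$, then: (b) $$\lim_{n\to\infty}\Phi\bigl(\mathrm{Prox}_{\gamma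 f}(\mathrm{Prox}_{\gamma g}(x_n)),\mathrm{Prox}_{\gamma g}(x_n)\bigr)=\lim_{n\to\infty}\Phi\bigl(\mathrm{Prox}_{\gamma f}(y_n),\mathrm{Prox}_{\gamma g}(\mathrm{Prox}_{\gamma f}(y_n))\bigr)=\inf_{x,y\in X}\Phi(x,y);$$ (c) $((x_n,y_n))_{n\ge0}$ converges weakly in $X^2$ to a minimizer of $\Phi$; (d) if $f$ or $g$ is uniformly convex, then $\Phi$ has exactly one minimizer, and $((x_n,y_n))_{n\ge0}$ converges to it in the metric of $X^2$. -/

import Mathlib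

open Filter Topology
open scoped NNReal ENNReal

namespace Hadamard

/-- A Hadamard space (complete CAT(0) space): a complete metric space in which any two points
have a midpoint satisfying the (CN) inequality of Bruhat and Tits. -/
class HadamardSpace (X : Type*) [MetricSpace X] : Prop extends CompleteSpace X where
  exists_midpoint : ∀ x y : X, ∃ m : X, ∀ z : X,
    dist z m ^ 2 ≤ 1 / 2 * dist z x ^ 2 + 1 / 2 * dist z y ^ 2 - 1 / 4 * dist x y ^ 2

section Basic

variable {X : Type*} [MetricSpace X]

/-- `p` is the point at parameter `t` of the geodesic joining `x` (at `t = 0`) to `y` (at `t = 1`).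
For `t ∈ [0, 1]` there is at most one such point, see `IsGeodesicPoint.unique`. -/
def IsGeodesicPoint (x y : X) (t : ℝ) (p : X) : Prop :=
  ∀ z : X, dist z p ^ 2 ≤
    (1 - t) * dist z x ^ 2 + t * dist z y ^ 2 - t * (1 - t) * dist x y ^ 2

theorem IsGeodesicPoint.unique {x y : X} {t : ℝ} (ht : t ∈ Set.Icc (0 : ℝ) 1) {p q : X}
    (hp : IsGeodesicPoint x y t p) (hq : IsGeodesicPoint x y t q) : p = q := by
  have h1 := hp q
  have h2 := hq x
  have h3 := hq y
  have e1 : dist x x = 0 := dist_self x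
  have e2 : dist y y = 0 := dist_self y
  rw [dist_comm x q, e1] at h2
  rw [dist_comm y q, dist_comm y x, e2] at h3
  have h0 : dist q p ^ 2 ≤ 0 := by
    nlinarith [mul_le_mul_of_nonneg_left h2 (sub_nonneg.2 ht.2),
      mul_le_mul_of_nonneg_left h3 ht.1]
  have h4 : dist q p = 0 := by
    have := sq_nonneg (dist q p)
    exact pow_eq_zero_iff (two_ne_zero) |>.1 (le_antisymm h0 this)
  exact (dist_eq_zero.1 h4).symm

/-- The geodesic segment `[x, y]`. -/
def geodesicSegment (x y : X) : Set X :=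
  {p | ∃ t ∈ Set.Icc (0 : ℝ) 1, IsGeodesicPoint x y t p}

/-- An extended-real-valued function is proper if it is not constantly `+∞` and never `-∞`. -/
def IsProper (f : X → EReal) : Prop :=
  (∃ x, f x ≠ ⊤) ∧ ∀ x, f x ≠ ⊥

/-- Convexity along geodesics (used for functions that never take the value `-∞`). -/
def IsConvex (f : X → EReal) : Prop :=
  ∀ x y : X, ∀ t ∈ Set.Icc (0 : ℝ) 1, ∀ p : X, IsGeodesicPoint x y t p →
    f p ≤ ((1 - t : ℝ) : EReal) * f x + (t : EReal) * f y

/-- Uniform convexity with some modulus `φ : [0, ∞) → [0, ∞]`.  The modulus term stands on the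
left-hand side, so that the inequality is void when the right-hand side is `+∞` and no
difference `∞ - ∞` occurs. -/
def IsUniformlyConvex (f : X → EReal) : Prop :=
  ∃ φ : ℝ≥0 → ℝ≥0∞, Monotone φ ∧ (∀ s, φ s = 0 ↔ s = 0) ∧
    ∀ x y : X, ∀ t ∈ Set.Icc (0 : ℝ) 1, ∀ p : X, IsGeodesicPoint x y t p →
      f p + ((t * (1 - t) : ℝ) : EReal) * ((φ (nndist x y) : ℝ≥0∞) : EReal) ≤
        ((1 - t : ℝ) : EReal) * f x + (t : EReal) * f y

/-- `p` minimizes `y ↦ f y + d(x, y)² / 2`. -/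
def IsProx (f : X → EReal) (x p : X) : Prop :=
  ∀ y : X, f p + ((1 / 2 * dist x p ^ 2 : ℝ) : EReal) ≤ f y + ((1 / 2 * dist x y ^ 2 : ℝ) : EReal)

open Classical in
/-- The proximal point of `f` corresponding to `x`: the minimizer of `y ↦ f y + d(x, y)² / 2`
(which exists and is unique when `f` is proper, convex and lower semicontinuous on a Hadamard
space; the value is `x` if there is no minimizer). -/
noncomputable def prox (f : X → EReal) (x : X) : X :=
  if h : ∃ p, IsProx f x p then h.choose else x

/-- `p` is a point of `C` nearest to `x`. -/
def IsProj (C : Set X) (x p : X) : Prop :=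
  p ∈ C ∧ ∀ y ∈ C, dist x p ≤ dist x y

open Classical in
/-- The metric projection onto `C` (the value is `x` if there is no nearest point in `C`). -/
noncomputable def proj (C : Set X) (x : X) : X :=
  if h : ∃ p, IsProj C x p then h.choose else x

/-- Weak convergence (Δ-convergence): for every `y`, the projections of the sequence onto the
geodesic segment `[x, y]` converge to `x`. -/
def WeaklyConverges (u : ℕ → X) (x : X) : Prop :=
  ∀ y : X, Tendsto (fun n => proj (geodesicSegment x y) (u n)) atTop (𝓝 x)

/-- `Φ(x, y) = f(x) + g(y) + d(x, y)² / (2γ)`. -/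
noncomputable def Phi (γ : ℝ) (f g : X → EReal) (x y : X) : EReal :=
  f x + g y + ((1 / (2 * γ) * dist x y ^ 2 : ℝ) : EReal)

/-- `(x, y)` minimizes `Φ` over `X × X`. -/
def IsSolution (γ : ℝ) (f g : X → EReal) (x y : X) : Prop :=
  ∀ u v : X, Phi γ f g x y ≤ Phi γ f g u v

/-- The proximal mapping `Prox_{γ f}` of the function `γ f`. -/
noncomputable def proxScaled (γ : ℝ) (f : X → EReal) : X → X :=
  prox (fun x => (γ : EReal) * f x)

/-- The point `(x, y)` of `X²` with the metric
`d((x₁, y₁), (x₂, y₂))² = d(x₁, x₂)² + d(y₁, y₂)²`. -/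
def pair (x y : X) : WithLp 2 (X × X) := WithLp.toLp 2 (x, y)

theorem dist_pair_sq (x₁ y₁ x₂ y₂ : X) :
    dist (pair x₁ y₁) (pair x₂ y₂) ^ 2 = dist x₁ x₂ ^ 2 + dist y₁ y₂ ^ 2 := by
  rw [WithLp.prod_dist_eq_add (by norm_num)]
  have h : 0 ≤ dist x₁ x₂ ^ 2 + dist y₁ y₂ ^ 2 := by positivity
  simp only [pair, ENNReal.toReal_ofNat, Real.rpow_ofNat]
  rw [← Real.sqrt_eq_rpow]
  exact Real.sq_sqrt h

end Basic

end Hadamard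

/-! Put F = 2γf, G = 2γg on the effective domains. Then 2γΦ is J(u, v) = F(u) + G(v) + d(u, v)², and
the proximal maps P, Q of F, G satisfy F(Px) + d(x, Px)² + d(Px, z)² ≤ F(z) + d(x, z)². Summing this
for Q at x and for P at Qx, and applying the quadrilateral inequality, gives the descent inequality
J(PQx, Qx) + d(PQx, u)² ≤ J(u, v) + d(x, u)² (`IsProxMap.coupled_add_le`).

Since P and Q are nonexpansive, (x_n) follows PQ and (y_n) follows QP with summable errors. Testing
descent against the preceding exact iterate and telescoping gives (a). If (u, v) minimizes J, then u
= PQu, so d(x_n, u) converges (quasi-Fejér monotonicity), and descent squeezes J to its minimum: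
(b).

For (c), the nonexpansive map (a, b) ↦ (Pb, Qa) of X² fixes exactly the minimizers of J; Opial's
lemma is proved for it through asymptotic centres along ultrafilters. For (d), uniform convexity
keeps J a fixed amount above its minimum away from u, so convergence of values forces convergence of
points. -/

namespace Hadamard

/-! ### Geodesics, projections and asymptotic centres -/

section Geometry

variable {X : Type*} [MetricSpace X]

theorem IsGeodesicPoint.dist_left_le {x y p : X} {t : ℝ} (ht : 0 ≤ t)
    (hp : IsGeodesicPoint x y t p) : dist x p ≤ t * dist x y := by
  have h := hp x
  rw [dist_self] at h
  exact abs_le_of_sq_le_sq' (by nlinarith) (by positivity) |>.2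

theorem IsGeodesicPoint.dist_right_le {x y p : X} {t : ℝ} (ht : t ≤ 1)
    (hp : IsGeodesicPoint x y t p) : dist y p ≤ (1 - t) * dist x y := by
  have h := hp y
  rw [dist_self, dist_comm y x] at h
  exact abs_le_of_sq_le_sq' (by nlinarith)
    (mul_nonneg (sub_nonneg.2 ht) dist_nonneg) |>.2

theorem IsGeodesicPoint.half_le {x y m : X} (hm : IsGeodesicPoint x y (1 / 2) m) (z : X) :
    dist z m ^ 2 ≤ (dist z x ^ 2 + dist z y ^ 2) / 2 - dist x y ^ 2 / 4 := by
  have := hm z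
  linarith

theorem IsGeodesicPoint.left (x y : X) : IsGeodesicPoint x y 0 x := fun z => by simp

variable [HadamardSpace X]

theorem exists_isGeodesicPoint_half (x y : X) : ∃ m, IsGeodesicPoint x y (1 / 2) m := by
  obtain ⟨m, hm⟩ := HadamardSpace.exists_midpoint x y
  exact ⟨m, fun z => by have := hm z; linarith⟩

/-- The sum of the squared diagonals of a quadrilateral is at most that of the squared sides. -/
theorem quadrilateral_le (a b c d : X) :
    dist a c ^ 2 + dist b d ^ 2 ≤
      dist a b ^ 2 + dist b c ^ 2 + dist c d ^ 2 + dist d a ^ 2 := by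
  obtain ⟨m, hm⟩ := exists_isGeodesicPoint_half a c
  have hb := hm.half_le b
  have hd := hm.half_le d
  have h := dist_triangle_right b d m
  rw [dist_comm b a] at hb
  rw [dist_comm d c] at hd
  have h2 : dist b d ^ 2 ≤ 2 * (dist b m ^ 2 + dist d m ^ 2) := by
    nlinarith [sq_nonneg (dist b m - dist d m), dist_nonneg (x := b) (y := d)]
  linarith

/-- Joint midpoint convexity of d²: three uses of (CN) leave the mixed terms d(x, y')² + d(x', y)²,
which the quadrilateral inequality absorbs. -/
theorem dist_midpoint_sq_le {x x' y y' m m' : X} (hm : IsGeodesicPoint x x' (1 / 2) m)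
    (hm' : IsGeodesicPoint y y' (1 / 2) m') :
    dist m m' ^ 2 ≤ (dist x y ^ 2 + dist x' y' ^ 2) / 2 := by
  have h0 := hm'.half_le m
  have h1 := hm.half_le y
  have h2 := hm.half_le y'
  rw [dist_comm m y, dist_comm m y'] at h0
  rw [dist_comm y x, dist_comm y x'] at h1
  rw [dist_comm y' x, dist_comm y' x'] at h2
  have h4 := quadrilateral_le x x' y' y
  rw [dist_comm y' y, dist_comm y x] at h4
  linarith

/-- A midpoint-strongly convex function that is bounded below and has closed sublevel sets
attains its minimum, and grows quadratically away from the minimizer. -/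
theorem exists_strong_minimizer {D : Set X} {F : X → ℝ} (hne : D.Nonempty)
    (hbdd : BddBelow (F '' D)) (hclosed : ∀ a, IsClosed {x | x ∈ D ∧ F x ≤ a})
    (hmid : ∀ x ∈ D, ∀ y ∈ D, ∃ m ∈ D, IsGeodesicPoint x y (1 / 2) m ∧
      F m ≤ (F x + F y) / 2 - dist x y ^ 2 / 4) :
    ∃ p ∈ D, ∀ z ∈ D, F p + dist p z ^ 2 ≤ F z := by
  have hle : ∀ z ∈ D, sInf (F '' D) ≤ F z := fun z hz =>
    csInf_le hbdd (Set.mem_image_of_mem F hz)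
  have hseq : ∀ n : ℕ, ∃ z ∈ D, F z < sInf (F '' D) + 1 / ((n : ℝ) + 1) := fun n => by
    obtain ⟨_, ⟨z, hz, rfl⟩, h⟩ := Real.lt_sInf_add_pos (hne.image F)
      (Nat.one_div_pos_of_nat (α := ℝ) (n := n))
    exact ⟨z, hz, h⟩
  choose z hzD hz using hseq
  have hlim := tendsto_one_div_add_atTop_nhds_zero_nat (𝕜 := ℝ)
  have hcauchy : CauchySeq z := by
    -- The midpoint of two near-minimizers cannot go below the infimum, so d²/4 ≤ 1/(N+1).
    refine cauchySeq_of_le_tendsto_0 (fun n : ℕ => √(4 * (1 / ((n : ℝ) + 1)))) ?_ ?_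
    · intro n m N hn hm
      obtain ⟨w, hwD, -, hw⟩ := hmid _ (hzD n) _ (hzD m)
      have h1 := hle w hwD
      have h2 := hz n
      have h3 := hz m
      have h4 := Nat.one_div_le_one_div (α := ℝ) hn
      have h5 := Nat.one_div_le_one_div (α := ℝ) hm
      exact Real.le_sqrt_of_sq_le (by linarith)
    · simpa using (hlim.const_mul 4).sqrt
  obtain ⟨p, hp⟩ := cauchySeq_tendsto_of_complete hcauchy
  have hpF : ∀ N : ℕ, p ∈ D ∧ F p ≤ sInf (F '' D) + 1 / ((N : ℝ) + 1) := fun N => by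
    refine (hclosed _).mem_of_tendsto hp ?_
    filter_upwards [eventually_ge_atTop N] with n hn
    exact ⟨hzD n, (hz n).le.trans (by gcongr)⟩
  have hpD := (hpF 0).1
  have hpmin : F p ≤ sInf (F '' D) :=
    ge_of_tendsto' (by simpa using hlim.const_add (sInf (F '' D))) fun N => (hpF N).2
  -- Bootstrap from midpoints: a growth constant c at the midpoint m gives (1 + c)/2 at w, and
  -- iterating from 0 gives 1 - 2⁻ᵏ → 1.
  have hgrow : ∀ k : ℕ, ∀ w ∈ D, F p + (1 - (1 / 2) ^ k) * dist p w ^ 2 ≤ F w := by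
    intro k
    induction k with
    | zero => intro w hw; simpa using hpmin.trans (hle w hw)
    | succ k ih =>
      intro w hw
      obtain ⟨m, hmD, hm, hmF⟩ := hmid p hpD w hw
      have h1 := ih m hmD
      have h2 := hm.dist_right_le (by norm_num)
      have h3 := dist_triangle_right p w m
      have h4 : dist p w / 2 ≤ dist p m := by linarith
      have h5 : dist p w ^ 2 / 4 ≤ dist p m ^ 2 := by nlinarith [dist_nonneg (x := p) (y := w)]
      have h6 : (0 : ℝ) ≤ 1 - (1 / 2) ^ k :=
        sub_nonneg.2 (pow_le_one₀ (by norm_num) (by norm_num))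
      have h7 := mul_le_mul_of_nonneg_left h5 h6
      rw [pow_succ]
      linarith
  refine ⟨p, hpD, fun w hw => le_of_tendsto' (x := atTop) ?_ fun k => hgrow k w hw⟩
  have := tendsto_pow_atTop_nhds_zero_of_lt_one (r := (1 / 2 : ℝ)) (by norm_num) (by norm_num)
  simpa using ((this.const_sub 1).mul_const (dist p w ^ 2)).const_add (F p)

/-- The point minimizes (1-t)d(x,·)² + t d(y,·)²; quadratic growth is then the defining inequality,
once the minimum is at least t(1-t)d(x,y)². -/
theorem exists_isGeodesicPoint (x y : X) {t : ℝ} (ht : t ∈ Set.Icc (0 : ℝ) 1) :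
    ∃ p, IsGeodesicPoint x y t p := by
  obtain ⟨ht0, ht1⟩ := ht
  have ht1' := sub_nonneg.2 ht1
  obtain ⟨p, -, hp⟩ := exists_strong_minimizer (D := Set.univ)
    (F := fun w => (1 - t) * dist x w ^ 2 + t * dist y w ^ 2) ⟨x, trivial⟩
    ⟨0, by rintro _ ⟨w, -, rfl⟩; positivity⟩
    (fun a => by
      simp only [Set.mem_univ, true_and]
      exact isClosed_le (by fun_prop) continuous_const)
    (fun a _ b _ => by
      obtain ⟨m, hm⟩ := exists_isGeodesicPoint_half a b
      refine ⟨m, trivial, hm, ?_⟩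
      have h1 := mul_le_mul_of_nonneg_left (hm.half_le x) ht1'
      have h2 := mul_le_mul_of_nonneg_left (hm.half_le y) ht0
      linarith)
  refine ⟨p, fun z => ?_⟩
  have h := hp z trivial
  have h2 : t * (1 - t) * dist x y ^ 2 ≤ (1 - t) * dist x p ^ 2 + t * dist y p ^ 2 := by
    have h3 := dist_triangle_right x y p
    have h4 : dist x y ^ 2 ≤ (dist x p + dist y p) ^ 2 := by gcongr
    have h5 := mul_le_mul_of_nonneg_left h4 (mul_nonneg ht0 ht1')
    nlinarith [sq_nonneg ((1 - t) * dist x p - t * dist y p)]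
  simp only [dist_comm z]
  linarith

/-- The parameters converge to some t along an ultrafilter. Testing the defining inequality at the
point q of parameter t, its right-hand side tends to at most 0. -/
theorem isCompact_geodesicSegment (x y : X) : IsCompact (geodesicSegment x y) := by
  rw [isCompact_iff_ultrafilter_le_nhds']
  intro U hU
  have hchoice : ∀ p : X, ∃ t : ℝ, p ∈ geodesicSegment x y →
      t ∈ Set.Icc (0 : ℝ) 1 ∧ IsGeodesicPoint x y t p := fun p => by
    by_cases hp : p ∈ geodesicSegment x y
    · obtain ⟨t, h⟩ := hp
      exact ⟨t, fun _ => h⟩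
    · exact ⟨0, fun h => absurd h hp⟩
  choose τ hτ using hchoice
  obtain ⟨t, ht, hUt⟩ := isCompact_Icc.ultrafilter_le_nhds' (U.map τ)
    (Ultrafilter.mem_map.2 (mem_of_superset hU fun p hp => (hτ p hp).1))
  have hUt' : Tendsto τ U (𝓝 t) := hUt
  obtain ⟨q, hq⟩ := exists_isGeodesicPoint x y ht
  refine ⟨q, ⟨t, ht, hq⟩, ?_⟩
  have hql := hq.dist_left_le ht.1
  have hqr := hq.dist_right_le ht.2
  have hub : Tendsto (fun p => (1 - τ p) * dist q x ^ 2 + τ p * dist q y ^ 2 -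
      τ p * (1 - τ p) * dist x y ^ 2) U
      (𝓝 ((1 - t) * dist q x ^ 2 + t * dist q y ^ 2 - t * (1 - t) * dist x y ^ 2)) :=
    (((hUt'.const_sub 1).mul_const _).add (hUt'.mul_const _)).sub
      ((hUt'.mul (hUt'.const_sub 1)).mul_const _)
  have hle0 : (1 - t) * dist q x ^ 2 + t * dist q y ^ 2 - t * (1 - t) * dist x y ^ 2 ≤ 0 := by
    have h1 : dist q x ^ 2 ≤ (t * dist x y) ^ 2 := by rw [dist_comm q]; gcongr
    have h2 : dist q y ^ 2 ≤ ((1 - t) * dist x y) ^ 2 := by rw [dist_comm q]; gcongr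
    nlinarith [mul_le_mul_of_nonneg_left h1 (sub_nonneg.2 ht.2),
      mul_le_mul_of_nonneg_left h2 ht.1]
  have hlim : Tendsto (fun p => dist q p ^ 2) U (𝓝 0) := by
    refine tendsto_order.2 ⟨fun a ha => Eventually.of_forall fun p => ha.trans_le (sq_nonneg _),
      fun a ha => ?_⟩
    filter_upwards [hub.eventually_lt_const (hle0.trans_lt ha), hU] with p hp hpS
    exact ((hτ p hpS).2 q).trans_lt hp
  have h0 : Tendsto (fun p => dist p q) U (𝓝 0) := by
    simpa [Real.sqrt_sq dist_nonneg, dist_comm q] using hlim.sqrt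
  exact tendsto_iff_dist_tendsto_zero.2 h0

theorem exists_midpoint_mem_geodesicSegment {x y p q : X} (hp : p ∈ geodesicSegment x y)
    (hq : q ∈ geodesicSegment x y) :
    ∃ m ∈ geodesicSegment x y, IsGeodesicPoint p q (1 / 2) m := by
  obtain ⟨s, hs, hp⟩ := hp
  obtain ⟨t, ht, hq⟩ := hq
  wlog hle : s ≤ t generalizing p q s t
  · obtain ⟨m, hm, h⟩ := this t ht hq s hs hp (le_of_not_ge hle)
    refine ⟨m, hm, fun z => ?_⟩
    have := h z
    rw [dist_comm q p] at this
    linarith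
  obtain ⟨m, hm⟩ := exists_isGeodesicPoint_half p q
  -- Averaging the inequalities of p and q falls short by (t-s)²d(x,y)²/4, which d(p,q)²/4 supplies.
  refine ⟨m, ⟨(s + t) / 2, ⟨by linarith [hs.1, ht.1], by linarith [hs.2, ht.2]⟩, fun z => ?_⟩, hm⟩
  have h1 := hm.half_le z
  have h2 := hp z
  have h3 := hq z
  have h4 := hp.dist_left_le hs.1
  have h5 := hq.dist_right_le ht.2
  have h6 := dist_triangle4 x p q y
  rw [dist_comm q y] at h6
  have h7 : (t - s) * dist x y ≤ dist p q := by linarith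
  have h8 : ((t - s) * dist x y) ^ 2 ≤ dist p q ^ 2 :=
    pow_le_pow_left₀ (mul_nonneg (sub_nonneg.2 hle) dist_nonneg) h7 2
  nlinarith

/-- The metric projection onto a geodesic segment satisfies the obtuse angle inequality. -/
theorem proj_geodesicSegment_spec (x y z : X) :
    proj (geodesicSegment x y) z ∈ geodesicSegment x y ∧ ∀ w ∈ geodesicSegment x y,
      dist z (proj (geodesicSegment x y) z) ^ 2 + dist (proj (geodesicSegment x y) z) w ^ 2 ≤
        dist z w ^ 2 := by
  obtain ⟨p, hpS, hp⟩ := exists_strong_minimizer (D := geodesicSegment x y)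
    (F := fun w => dist z w ^ 2) ⟨x, 0, by simp, .left x y⟩
    ⟨0, by rintro _ ⟨w, -, rfl⟩; positivity⟩
    (fun a => (isCompact_geodesicSegment x y).isClosed.inter
      (isClosed_le ((continuous_const.dist continuous_id).pow 2) continuous_const))
    (fun a ha b hb => by
      obtain ⟨m, hmS, hm⟩ := exists_midpoint_mem_geodesicSegment ha hb
      exact ⟨m, hmS, hm, hm.half_le z⟩)
  have hproj : IsProj (geodesicSegment x y) z p :=
    ⟨hpS, fun w hw => abs_le_of_sq_le_sq' (by linarith [hp w hw, sq_nonneg (dist p w)])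
      dist_nonneg |>.2⟩
  have hex : ∃ p, IsProj (geodesicSegment x y) z p := ⟨p, hproj⟩
  have heq : proj (geodesicSegment x y) z = p := by
    rw [proj, dif_pos hex]
    obtain ⟨hcS, hc⟩ := hex.choose_spec
    have h1 := hp _ hcS
    have h2 : dist z hex.choose ^ 2 ≤ dist z p ^ 2 := by gcongr; exact hc p hpS
    have h3 : dist p hex.choose ^ 2 = 0 := le_antisymm (by linarith) (sq_nonneg _)
    exact (dist_eq_zero.1 (pow_eq_zero_iff two_ne_zero |>.1 h3)).symm
  rw [heq]
  exact ⟨hpS, hp⟩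

instance : HadamardSpace (WithLp 2 (X × X)) where
  exists_midpoint := by
    rintro ⟨x₁, y₁⟩ ⟨x₂, y₂⟩
    obtain ⟨m, hm⟩ := HadamardSpace.exists_midpoint x₁ x₂
    obtain ⟨m', hm'⟩ := HadamardSpace.exists_midpoint y₁ y₂
    refine ⟨pair m m', ?_⟩
    rintro ⟨z, z'⟩
    have h1 := dist_pair_sq z z' m m'
    have h2 := dist_pair_sq z z' x₁ y₁
    have h3 := dist_pair_sq z z' x₂ y₂
    have h4 := dist_pair_sq x₁ y₁ x₂ y₂
    have h5 := hm z
    have h6 := hm' z'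
    simp only [pair] at *
    linarith

/-- Asymptotic centre of a bounded sequence along an ultrafilter. -/
theorem exists_asymptotic_center {z : ℕ → X} {a : X} {B : ℝ} (hB : ∀ n, dist (z n) a ≤ B)
    (U : Ultrafilter ℕ) :
    ∃ (ρ : X → ℝ) (c : X), (∀ w, Tendsto (fun n => dist (z n) w) U (𝓝 (ρ w))) ∧
      ∀ w, ρ c ^ 2 + dist c w ^ 2 ≤ ρ w ^ 2 := by
  have hlim : ∀ w, ∃ r : ℝ, Tendsto (fun n => dist (z n) w) U (𝓝 r) := fun w => by
    obtain ⟨r, -, hr⟩ := (isCompact_Icc (a := (0 : ℝ)) (b := B + dist a w)).ultrafilter_le_nhds'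
      (U.map fun n => dist (z n) w)
      (Ultrafilter.mem_map.2 (univ_mem' fun n =>
        ⟨dist_nonneg, (dist_triangle _ a w).trans (by have := hB n; gcongr)⟩))
    exact ⟨r, hr⟩
  choose ρ hρ using hlim
  have hcont : Continuous ρ := by
    refine (LipschitzWith.of_le_add fun v w => ?_ : LipschitzWith 1 ρ).continuous
    refine le_of_tendsto_of_tendsto' (hρ v) ((hρ w).add_const _) fun n => ?_
    rw [dist_comm v]
    exact dist_triangle _ _ _
  obtain ⟨c, -, hc⟩ := exists_strong_minimizer (D := Set.univ) (F := fun w => ρ w ^ 2)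
    ⟨a, trivial⟩ ⟨0, by rintro _ ⟨w, -, rfl⟩; positivity⟩
    (fun r => by
      simp only [Set.mem_univ, true_and]
      exact isClosed_le (hcont.pow 2) continuous_const)
    (fun v _ w _ => by
      obtain ⟨m, hm⟩ := exists_isGeodesicPoint_half v w
      exact ⟨m, trivial, hm, le_of_tendsto_of_tendsto' ((hρ m).pow 2)
        (((((hρ v).pow 2).add ((hρ w).pow 2)).div_const 2).sub_const _)
        fun n => hm.half_le (z n)⟩)
  exact ⟨ρ, c, hρ, fun w => hc w trivial⟩

/-- Opial's lemma: an asymptotically regular sequence whose distances to the fixed points of a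
nonexpansive map converge is weakly convergent to a fixed point. -/
theorem exists_weaklyConverges_fixedPoint {R : X → X} (hR : ∀ v w, dist (R v) (R w) ≤ dist v w)
    {z : ℕ → X} (hz : Tendsto (fun n => dist (z n) (R (z n))) atTop (𝓝 0))
    (hfix : ∃ w, R w = w)
    (hdist : ∀ w, R w = w → ∃ l : ℝ, Tendsto (fun n => dist (z n) w) atTop (𝓝 l)) :
    ∃ c, R c = c ∧ WeaklyConverges z c := by
  obtain ⟨w₀, hw₀⟩ := hfix
  obtain ⟨B, hB⟩ : ∃ B, ∀ n, dist (z n) w₀ ≤ B := by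
    obtain ⟨l, hl⟩ := hdist w₀ hw₀
    obtain ⟨B, hB⟩ := hl.bddAbove_range
    exact ⟨B, fun n => hB ⟨n, rfl⟩⟩
  choose ρ c hρ hc using fun U : Ultrafilter ℕ => exists_asymptotic_center hB U
  have hnn : ∀ U w, 0 ≤ ρ U w := fun U w => ge_of_tendsto' (hρ U w) fun n => dist_nonneg
  have hcfix : ∀ U : Ultrafilter ℕ, ↑U ≤ (atTop : Filter ℕ) → R (c U) = c U := by
    intro U hU
    -- R(c) is no farther from the sequence asymptotically than c, so it equals the unique centre.
    have h1 : ρ U (R (c U)) ≤ ρ U (c U) := by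
      refine le_of_tendsto_of_tendsto' (hρ U _)
        (by simpa using (hz.mono_left hU).add (hρ U (c U))) fun n => ?_
      exact (dist_triangle _ (R (z n)) _).trans (by gcongr; exact hR _ _)
    have h2 : ρ U (R (c U)) ^ 2 ≤ ρ U (c U) ^ 2 := pow_le_pow_left₀ (hnn U _) h1 2
    have h3 : dist (c U) (R (c U)) ^ 2 = 0 :=
      le_antisymm (by linarith [hc U (R (c U))]) (sq_nonneg _)
    exact (dist_eq_zero.1 (pow_eq_zero_iff two_ne_zero |>.1 h3)).symm
  have hsame : ∀ U V : Ultrafilter ℕ, ↑U ≤ (atTop : Filter ℕ) → ↑V ≤ (atTop : Filter ℕ) →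
      ∀ w, R w = w → ρ U w = ρ V w := by
    intro U V hU hV w hw
    obtain ⟨l, hl⟩ := hdist w hw
    rw [tendsto_nhds_unique (hρ U w) (hl.mono_left hU),
      tendsto_nhds_unique (hρ V w) (hl.mono_left hV)]
  -- Both centres are fixed points, where ρ does not depend on the ultrafilter; each thus minimizes
  -- the same values.
  have hceq : ∀ U V : Ultrafilter ℕ, ↑U ≤ (atTop : Filter ℕ) → ↑V ≤ (atTop : Filter ℕ) →
      c U = c V := by
    intro U V hU hV
    have h1 := hc U (c V)
    have h2 := hc V (c U)
    rw [hsame V U hV hU _ (hcfix V hV), hsame V U hV hU _ (hcfix U hU)] at h2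
    have h3 : dist (c U) (c V) ^ 2 = 0 :=
      le_antisymm (by linarith [sq_nonneg (dist (c V) (c U))]) (sq_nonneg _)
    exact dist_eq_zero.1 (pow_eq_zero_iff two_ne_zero |>.1 h3)
  have hUle := Ultrafilter.of_le (atTop : Filter ℕ)
  refine ⟨c (Ultrafilter.of atTop), hcfix _ hUle, fun y => ?_⟩
  rw [tendsto_iff_ultrafilter]
  intro U hU
  rw [hceq _ U hUle hU]
  set π : ℕ → X := fun n => proj (geodesicSegment (c U) y) (z n) with hπ
  have hspec := fun n => proj_geodesicSegment_spec (c U) y (z n)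
  -- In the limit the obtuse angle inequality gives ρ(p)² + d(p, c)² ≤ ρ(c)², and minimality of ρ(c)
  -- forces p = c.
  obtain ⟨p, hpS, hp⟩ := (isCompact_geodesicSegment (c U) y).ultrafilter_le_nhds'
    (U.map π) (Ultrafilter.mem_map.2 (univ_mem' fun n => (hspec n).1))
  have hp' : Tendsto π U (𝓝 p) := hp
  have hd : Tendsto (fun n => dist (z n) (π n)) U (𝓝 (ρ U p)) := by
    have h0 := tendsto_iff_dist_tendsto_zero.1 hp'
    refine tendsto_of_tendsto_of_tendsto_of_le_of_le (by simpa using (hρ U p).sub h0)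
      (by simpa using (hρ U p).add h0) (fun n => ?_) fun n => ?_
    · have := dist_triangle (z n) (π n) p
      simp only; linarith
    · exact (dist_triangle_right _ _ p).trans (by simp)
  have h1 : ρ U p ^ 2 + dist p (c U) ^ 2 ≤ ρ U (c U) ^ 2 :=
    le_of_tendsto_of_tendsto' ((hd.pow 2).add ((hp'.dist tendsto_const_nhds).pow 2))
      ((hρ U (c U)).pow 2) fun n => (hspec n).2 _ ⟨0, by simp, .left _ _⟩
  have h2 := hc U p
  have h3 : dist p (c U) ^ 2 = 0 :=
    le_antisymm (by linarith [sq_nonneg (dist (c U) p)]) (sq_nonneg _)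
  rw [← dist_eq_zero.1 (pow_eq_zero_iff two_ne_zero |>.1 h3)]
  exact hp'

end Geometry

/-! ### Proximal maps and alternating minimization -/

section ProximalMaps

variable {X : Type*} [MetricSpace X]

/-- `P` maps every `x` to the minimizer over `D` of `F + d(x, ·)²`, characterized by its
variational inequality. -/
structure IsProxMap (D : Set X) (F : X → ℝ) (P : X → X) : Prop where
  mem : ∀ x, P x ∈ D
  le : ∀ x, ∀ z ∈ D, F (P x) + dist x (P x) ^ 2 + dist (P x) z ^ 2 ≤ F z + dist x z ^ 2

/-- Midpoint convexity of the real-valued function `F` on the domain `D`. -/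
def IsMidConvexOn (D : Set X) (F : X → ℝ) : Prop :=
  ∀ x ∈ D, ∀ y ∈ D, ∀ m, IsGeodesicPoint x y (1 / 2) m → m ∈ D ∧ F m ≤ (F x + F y) / 2

/-- Uniform midpoint convexity of the real-valued function `F` on the domain `D`. -/
def IsUniformlyMidConvexOn (D : Set X) (F : X → ℝ) : Prop :=
  ∀ δ > 0, ∃ η > 0, ∀ x ∈ D, ∀ y ∈ D, ∀ m, IsGeodesicPoint x y (1 / 2) m → δ ≤ dist x y →
    F m + η ≤ (F x + F y) / 2

/-- The coupled objective `F(u) + G(v) + d(u, v)²`. -/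
def coupled (F G : X → ℝ) (u v : X) : ℝ := F u + G v + dist u v ^ 2

theorem coupled_swap (F G : X → ℝ) (u v : X) : coupled F G u v = coupled G F v u := by
  rw [coupled, coupled, dist_comm]
  ring

/-- `(u, v)` minimizes the coupled objective over `D × E`. -/
structure IsCoupledMin (D E : Set X) (F G : X → ℝ) (u v : X) : Prop where
  left_mem : u ∈ D
  right_mem : v ∈ E
  le : ∀ w ∈ D, ∀ z ∈ E, coupled F G u v ≤ coupled F G w z

theorem IsCoupledMin.swap {D E : Set X} {F G : X → ℝ} {u v : X}
    (h : IsCoupledMin D E F G u v) : IsCoupledMin E D G F v u :=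
  ⟨h.right_mem, h.left_mem, fun w hw z hz => by
    rw [coupled_swap G, coupled_swap G]
    exact h.le z hz w hw⟩

variable {D E : Set X} {F G : X → ℝ} {P Q : X → X} {u v : X} {x : ℕ → X}

theorem IsCoupledMin.left_eq (h : IsCoupledMin D E F G u v) (hP : IsProxMap D F P) :
    P v = u := by
  have h1 := h.le _ (hP.mem v) v h.right_mem
  have h2 := hP.le v u h.left_mem
  simp only [coupled] at h1
  rw [dist_comm u v, dist_comm (P v) v] at h1
  have h3 : dist (P v) u ^ 2 = 0 := le_antisymm (by linarith) (sq_nonneg _)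
  exact dist_eq_zero.1 (pow_eq_zero_iff two_ne_zero |>.1 h3)

theorem IsCoupledMin.right_eq (h : IsCoupledMin D E F G u v) (hQ : IsProxMap E G Q) :
    Q u = v :=
  h.swap.left_eq hQ

theorem summable_sq {ε : ℕ → ℝ} (h0 : ∀ n, 0 ≤ ε n) (h : Summable ε) :
    Summable fun n => ε n ^ 2 := by
  refine Summable.of_norm_bounded_eventually_nat h ?_
  filter_upwards [h.tendsto_atTop_zero.eventually_le_const one_pos] with n hn
  rw [Real.norm_of_nonneg (sq_nonneg _)]
  nlinarith [h0 n]

/-- Inexact iterates of a nonexpansive map are quasi-Fejér monotone. -/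
theorem exists_tendsto_dist_fixedPoint {R : X → X} (hR : ∀ v w, dist (R v) (R w) ≤ dist v w)
    (hx : Summable fun n => dist (x (n + 1)) (R (x n))) (hu : R u = u) :
    ∃ l : ℝ, Tendsto (fun n => dist (x n) u) atTop (𝓝 l) := by
  set ε : ℕ → ℝ := fun n => dist (x (n + 1)) (R (x n)) with hε
  have hstep : ∀ n, dist (x (n + 1)) u ≤ dist (x n) u + ε n := fun n => by
    have h1 := dist_triangle (x (n + 1)) (R (x n)) u
    have h2 := hR (x n) u
    rw [hu] at h2
    simp only [hε]
    linarith
  -- Subtracting the accumulated errors makes the distances decrease.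
  have hanti : Antitone fun n => dist (x n) u - ∑ k ∈ Finset.range n, ε k :=
    antitone_nat_of_succ_le fun n => by
      rw [Finset.sum_range_succ]
      linarith [hstep n]
  have hbdd : BddBelow (Set.range fun n => dist (x n) u - ∑ k ∈ Finset.range n, ε k) := by
    refine ⟨-∑' k, ε k, ?_⟩
    rintro _ ⟨n, rfl⟩
    have h1 := hx.sum_le_tsum (Finset.range n) fun k _ => dist_nonneg
    have h2 := dist_nonneg (x := x n) (y := u)
    simp only
    linarith
  refine ⟨_, ((tendsto_atTop_ciInf hanti hbdd).add hx.hasSum.tendsto_sum_nat).congr fun n => ?_⟩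
  simp [hε]

variable [HadamardSpace X]

/-- Adding the variational inequalities at x and y cancels F; the quadrilateral inequality does the
rest. -/
theorem IsProxMap.dist_le (hP : IsProxMap D F P) (x y : X) :
    dist (P x) (P y) ≤ dist x y := by
  have h1 := hP.le x _ (hP.mem y)
  have h2 := hP.le y _ (hP.mem x)
  have h5 := quadrilateral_le x (P x) (P y) y
  simp only [dist_comm (P y) (P x), dist_comm (P x) y,
    dist_comm (P y) y, dist_comm y x] at *
  exact abs_le_of_sq_le_sq' (by linarith) dist_nonneg |>.2

/-- A function whose prox objective is bounded below at one centre has a prox at every centre. -/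
theorem exists_prox (hne : D.Nonempty) (hconv : IsMidConvexOn D F)
    (hclosed : ∀ r : X → ℝ, Continuous r → IsClosed {z | z ∈ D ∧ F z ≤ r z})
    {a : X} {C : ℝ} (hbdd : ∀ z ∈ D, C ≤ F z + dist a z ^ 2) (x : X) :
    ∃ p ∈ D, ∀ z ∈ D, F p + dist x p ^ 2 + dist p z ^ 2 ≤ F z + dist x z ^ 2 := by
  have key : ∀ (b : X) (K : ℝ), (∀ z ∈ D, K ≤ F z + dist b z ^ 2) →
      ∃ p ∈ D, ∀ z ∈ D, F p + dist b p ^ 2 + dist p z ^ 2 ≤ F z + dist b z ^ 2 := by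
    intro b K hK
    refine exists_strong_minimizer (F := fun z => F z + dist b z ^ 2) hne
      ⟨K, by rintro _ ⟨z, hz, rfl⟩; exact hK z hz⟩ (fun r => ?_) (fun y hy z hz => ?_)
    · have := hclosed (fun z => r - dist b z ^ 2)
        (continuous_const.sub ((continuous_const.dist continuous_id).pow 2))
      simpa only [le_sub_iff_add_le] using this
    · obtain ⟨m, hm⟩ := exists_isGeodesicPoint_half y z
      obtain ⟨hmD, hmF⟩ := hconv y hy z hz m hm
      exact ⟨m, hmD, hm, by linarith [hm.half_le b]⟩
  obtain ⟨p, -, hp⟩ := key a C hbdd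
  set A := dist a p
  set B := dist x p
  -- The prox inequality at a gives F(z) ≥ F(p) - 2A d(p,z), and d(p,z) ≤ B + d(x,z); completing the
  -- square in d(x,z) gives the constant.
  refine key x (F p - A ^ 2 - 2 * A * B) fun z hz => ?_
  have h1 := hp z hz
  have h2 := dist_triangle a p z
  have h3 := dist_triangle_left p z x
  have hA : 0 ≤ A := dist_nonneg
  have h4 : dist a z ^ 2 ≤ (A + dist p z) ^ 2 := by gcongr
  nlinarith [mul_le_mul_of_nonneg_left h3 hA, sq_nonneg (dist x z - A)]

/-- The descent inequality of the alternating proximal scheme. -/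
theorem IsProxMap.coupled_add_le (hP : IsProxMap D F P) (hQ : IsProxMap E G Q) (hu : u ∈ D)
    (hv : v ∈ E) (x : X) :
    coupled F G (P (Q x)) (Q x) + dist (P (Q x)) u ^ 2 ≤ coupled F G u v + dist x u ^ 2 := by
  have h1 := hQ.le x v hv
  have h2 := hP.le (Q x) u hu
  have h5 := quadrilateral_le x u v (Q x)
  simp only [coupled]
  simp only [dist_comm (Q x) x, dist_comm u (Q x),
    dist_comm v (Q x), dist_comm (P (Q x)) (Q x)] at *
  linarith

/-- At a fixed point u of PQ, both sides of the descent inequality contain d(u, w)², and what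
remains is minimality. -/
theorem IsProxMap.isCoupledMin (hP : IsProxMap D F P) (hQ : IsProxMap E G Q)
    (hu : P v = u) (hv : Q u = v) : IsCoupledMin D E F G u v := by
  refine ⟨hu ▸ hP.mem v, hv ▸ hQ.mem u, fun w hw z hz => ?_⟩
  have h := hP.coupled_add_le hQ hw hz u
  rw [hv, hu] at h
  linarith

/-- The inexact alternating scheme has square-summable steps when the objective is bounded
below. -/
theorem IsProxMap.summable_dist_sq (hP : IsProxMap D F P) (hQ : IsProxMap E G Q) {c : ℝ}
    (hc : ∀ u ∈ D, ∀ v ∈ E, c ≤ coupled F G u v)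
    (hx : Summable fun n => dist (x (n + 1)) (P (Q (x n)))) :
    Summable fun n => dist (x (n + 1)) (x n) ^ 2 := by
  have hε := summable_sq (fun n => dist_nonneg) hx
  set s : ℕ → X := fun n => P (Q (x n)) with hs
  set W : ℕ → ℝ := fun n => coupled F G (s n) (Q (x n)) with hW
  -- Descent from x_{n+1}, tested against the preceding exact pair.
  have hstep : ∀ n, W (n + 1) + dist (s (n + 1)) (s n) ^ 2 ≤ W n + dist (x (n + 1)) (s n) ^ 2 :=
    fun n => hP.coupled_add_le hQ (hP.mem _) (hQ.mem _) (x (n + 1))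
  have hsum : ∀ N, W N + ∑ n ∈ Finset.range N, dist (s (n + 1)) (s n) ^ 2 ≤
      W 0 + ∑ n ∈ Finset.range N, dist (x (n + 1)) (s n) ^ 2 := by
    intro N
    induction N with
    | zero => simp
    | succ N ih =>
      rw [Finset.sum_range_succ, Finset.sum_range_succ]
      linarith [hstep N]
  have hsq : Summable fun n => dist (s (n + 1)) (s n) ^ 2 := by
    refine summable_of_sum_range_le (c := W 0 + ∑' n, dist (x (n + 1)) (s n) ^ 2 - c)
      (fun n => sq_nonneg _) fun N => ?_
    have h1 := hsum N
    have h2 := hc _ (hP.mem (Q (x N))) _ (hQ.mem (x N))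
    have h3 := hε.sum_le_tsum (Finset.range N) fun n _ => sq_nonneg _
    simp only [hW, hs] at *
    linarith
  rw [← summable_nat_add_iff 1]
  refine Summable.of_nonneg_of_le (fun n => sq_nonneg _) (fun n => ?_)
    ((((summable_nat_add_iff 1).2 hε).add hsq).add hε |>.mul_left 3)
  have h := dist_triangle4 (x (n + 1 + 1)) (s (n + 1)) (s n) (x (n + 1))
  rw [dist_comm (s n)] at h
  have h2 : dist (x (n + 1 + 1)) (x (n + 1)) ^ 2 ≤ (dist (x (n + 1 + 1)) (s (n + 1)) +
    dist (s (n + 1)) (s n) + dist (x (n + 1)) (s n)) ^ 2 := by gcongr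
  nlinarith [sq_nonneg (dist (x (n + 1 + 1)) (s (n + 1)) - dist (s (n + 1)) (s n)),
    sq_nonneg (dist (x (n + 1 + 1)) (s (n + 1)) - dist (x (n + 1)) (s n)),
    sq_nonneg (dist (s (n + 1)) (s n) - dist (x (n + 1)) (s n))]

theorem IsProxMap.comp_dist_le (hP : IsProxMap D F P) (hQ : IsProxMap E G Q) (v w : X) :
    dist (P (Q v)) (P (Q w)) ≤ dist v w :=
  (hP.dist_le _ _).trans (hQ.dist_le _ _)

theorem IsProxMap.summable_dist_comp (hP : IsProxMap D F P) {y z : ℕ → X}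
    (hx : Summable fun n => dist (x n) (P (y n))) (hy : Summable fun n => dist (y n) (z n)) :
    Summable fun n => dist (x n) (P (z n)) :=
  Summable.of_nonneg_of_le (fun n => dist_nonneg)
    (fun n => (dist_triangle _ (P (y n)) _).trans (by gcongr; exact hP.dist_le _ _)) (hx.add hy)

theorem IsProxMap.tendsto_of_tendsto_dist (hP : IsProxMap D F P) {y : ℕ → X}
    (hx : Tendsto x atTop (𝓝 u)) (hy : Tendsto (fun n => dist (y n) (P (x n))) atTop (𝓝 0)) :
    Tendsto y atTop (𝓝 (P u)) := by
  rw [tendsto_iff_dist_tendsto_zero] at *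
  exact squeeze_zero (fun n => dist_nonneg)
    (fun n => (dist_triangle _ (P (x n)) _).trans (add_le_add le_rfl (hP.dist_le _ _)))
    (by simpa using hy.add hx)

theorem IsCoupledMin.exists_tendsto_dist (h : IsCoupledMin D E F G u v) (hP : IsProxMap D F P)
    (hQ : IsProxMap E G Q) (hx : Summable fun n => dist (x (n + 1)) (P (Q (x n)))) :
    ∃ l : ℝ, Tendsto (fun n => dist (x n) u) atTop (𝓝 l) :=
  exists_tendsto_dist_fixedPoint (hP.comp_dist_le hQ) hx (by rw [h.right_eq hQ, h.left_eq hP])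

/-- x_n and PQx_n have the same limiting distance to u, so the excess allowed by descent vanishes.
-/
theorem IsCoupledMin.tendsto_coupled (h : IsCoupledMin D E F G u v) (hP : IsProxMap D F P)
    (hQ : IsProxMap E G Q) (hx : Summable fun n => dist (x (n + 1)) (P (Q (x n)))) :
    Tendsto (fun n => coupled F G (P (Q (x n))) (Q (x n))) atTop (𝓝 (coupled F G u v)) := by
  obtain ⟨l, hl⟩ := h.exists_tendsto_dist hP hQ hx
  have hs : Tendsto (fun n => dist (P (Q (x n))) u) atTop (𝓝 l) := by
    have h1 := (tendsto_add_atTop_iff_nat 1).2 hl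
    have h2 := hx.tendsto_atTop_zero
    refine tendsto_of_tendsto_of_tendsto_of_le_of_le (by simpa using h1.sub h2)
      (by simpa using h1.add h2) (fun n => ?_) fun n => ?_
    · have := dist_triangle (x (n + 1)) (P (Q (x n))) u
      simp only
      linarith
    · have := dist_triangle_left (P (Q (x n))) u (x (n + 1))
      simp only
      linarith
  have hub : Tendsto (fun n => coupled F G u v + dist (x n) u ^ 2 - dist (P (Q (x n))) u ^ 2)
      atTop (𝓝 (coupled F G u v)) := by
    simpa using ((hl.pow 2).const_add (coupled F G u v)).sub (hs.pow 2)
  refine tendsto_of_tendsto_of_tendsto_of_le_of_le tendsto_const_nhds hub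
    (fun n => h.le _ (hP.mem _) _ (hQ.mem _)) fun n => ?_
  have := hP.coupled_add_le hQ h.left_mem h.right_mem (x n)
  simp only
  linarith

/-- Under uniform convexity in the first variable, the objective has a definite gap away from the
minimizer. -/
theorem IsCoupledMin.exists_gap (h : IsCoupledMin D E F G u v) (hF : IsMidConvexOn D F)
    (hFu : IsUniformlyMidConvexOn D F) (hG : IsMidConvexOn E G) {δ : ℝ} (hδ : 0 < δ) :
    ∃ η > 0, ∀ w ∈ D, ∀ z ∈ E, δ ≤ dist u w → coupled F G u v + η ≤ coupled F G w z := by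
  obtain ⟨η, hη, hgap⟩ := hFu δ hδ
  refine ⟨η, hη, fun w hw z hz hd => ?_⟩
  obtain ⟨m, hm⟩ := exists_isGeodesicPoint_half u w
  obtain ⟨m', hm'⟩ := exists_isGeodesicPoint_half v z
  have h1 := hgap u h.left_mem w hw m hm hd
  obtain ⟨h2, h3⟩ := hG v h.right_mem z hz m' hm'
  have h4 := h.le m (hF u h.left_mem w hw m hm).1 m' h2
  have h5 := dist_midpoint_sq_le hm hm'
  simp only [coupled] at *
  linarith

/-- The gap forces the exact iterates PQx_n to u, since their values tend to the minimum; x_{n+1}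
differs from them by a vanishing error. -/
theorem IsCoupledMin.tendsto_of_uniformlyMidConvexOn (h : IsCoupledMin D E F G u v)
    (hP : IsProxMap D F P) (hQ : IsProxMap E G Q) (hF : IsMidConvexOn D F)
    (hFu : IsUniformlyMidConvexOn D F) (hG : IsMidConvexOn E G)
    (hx : Summable fun n => dist (x (n + 1)) (P (Q (x n)))) :
    Tendsto x atTop (𝓝 u) := by
  have hs : Tendsto (fun n => dist (P (Q (x n))) u) atTop (𝓝 0) := by
    refine tendsto_order.2 ⟨fun a ha => Eventually.of_forall fun n => ha.trans_le dist_nonneg,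
      fun δ hδ => ?_⟩
    obtain ⟨η, hη, hgap⟩ := h.exists_gap hF hFu hG hδ
    filter_upwards [(h.tendsto_coupled hP hQ hx).eventually_lt_const
      (lt_add_of_pos_right _ hη)] with n hn
    by_contra! hle
    rw [dist_comm] at hle
    exact (hgap _ (hP.mem _) _ (hQ.mem _) hle).not_gt hn
  rw [← tendsto_add_atTop_iff_nat 1, tendsto_iff_dist_tendsto_zero]
  exact squeeze_zero (fun n => dist_nonneg) (fun n => dist_triangle _ _ _)
    (by simpa using hx.tendsto_atTop_zero.add hs)

theorem IsCoupledMin.left_unique (h : IsCoupledMin D E F G u v) (hF : IsMidConvexOn D F)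
    (hFu : IsUniformlyMidConvexOn D F) (hG : IsMidConvexOn E G) {u' v' : X}
    (h' : IsCoupledMin D E F G u' v') : u' = u := by
  by_contra hne
  obtain ⟨η, hη, hgap⟩ := h.exists_gap hF hFu hG (dist_pos.2 (Ne.symm hne))
  have h1 := hgap u' h'.left_mem v' h'.right_mem le_rfl
  have h2 := h'.le u h.left_mem v h.right_mem
  linarith

end ProximalMaps

/-! ### Weak convergence in the product -/

section WeakConvergence

variable {X : Type*} [MetricSpace X] {D E : Set X} {F G : X → ℝ} {P Q : X → X} {x y : ℕ → X}

theorem tendsto_dist_pair {a b a' b' : ℕ → X} {l l' : ℝ}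
    (h : Tendsto (fun n => dist (a n) (b n)) atTop (𝓝 l))
    (h' : Tendsto (fun n => dist (a' n) (b' n)) atTop (𝓝 l')) :
    Tendsto (fun n => dist (pair (a n) (a' n)) (pair (b n) (b' n))) atTop
      (𝓝 (√(l ^ 2 + l' ^ 2))) := by
  refine ((h.pow 2).add (h'.pow 2)).sqrt.congr fun n => ?_
  rw [← dist_pair_sq, Real.sqrt_sq dist_nonneg]

theorem tendsto_pair {u v : X} (hx : Tendsto x atTop (𝓝 u)) (hy : Tendsto y atTop (𝓝 v)) :
    Tendsto (fun n => pair (x n) (y n)) atTop (𝓝 (pair u v)) := by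
  rw [tendsto_iff_dist_tendsto_zero] at *
  simpa using tendsto_dist_pair hx hy

theorem tendsto_dist_zero_of_summable_sq (h : Summable fun n => dist (x (n + 1)) (x n) ^ 2) :
    Tendsto (fun n => dist (x (n + 1)) (x n)) atTop (𝓝 0) := by
  simpa [Real.sqrt_sq dist_nonneg] using h.tendsto_atTop_zero.sqrt

theorem IsProxMap.exists_weaklyConverges [HadamardSpace X] (hP : IsProxMap D F P) (hQ : IsProxMap E G Q)
    (hmin : ∃ u v, IsCoupledMin D E F G u v)
    (hy : Tendsto (fun n => dist (y n) (Q (x n))) atTop (𝓝 0))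
    (hx : Tendsto (fun n => dist (x (n + 1)) (P (y n))) atTop (𝓝 0))
    (hxx : Tendsto (fun n => dist (x (n + 1)) (x n)) atTop (𝓝 0))
    (hdist : ∀ u v, IsCoupledMin D E F G u v →
      (∃ l : ℝ, Tendsto (fun n => dist (x n) u) atTop (𝓝 l)) ∧
        ∃ l : ℝ, Tendsto (fun n => dist (y n) v) atTop (𝓝 l)) :
    ∃ u v, IsCoupledMin D E F G u v ∧
      WeaklyConverges (fun n => pair (x n) (y n)) (pair u v) := by
  let R : WithLp 2 (X × X) → WithLp 2 (X × X) := fun z => pair (P z.snd) (Q z.fst)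
  have hfix : ∀ u v, R (pair u v) = pair u v → IsCoupledMin D E F G u v := fun u v h =>
    hP.isCoupledMin hQ (congrArg WithLp.fst h) (congrArg WithLp.snd h)
  have hR : ∀ z w, dist (R z) (R w) ≤ dist z w := by
    rintro ⟨a, b⟩ ⟨c, d⟩
    refine abs_le_of_sq_le_sq' ?_ dist_nonneg |>.2
    change dist (pair (P b) (Q a)) (pair (P d) (Q c)) ^ 2 ≤ dist (pair a b) (pair c d) ^ 2
    rw [dist_pair_sq, dist_pair_sq, add_comm]
    gcongr
    · exact hQ.dist_le _ _
    · exact hP.dist_le _ _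
  -- Asymptotic regularity needs x_n near P(y_n), but the error bound concerns x_{n+1}; vanishing
  -- steps bridge the shift.
  have hxP : Tendsto (fun n => dist (x n) (P (y n))) atTop (𝓝 0) :=
    squeeze_zero (fun n => dist_nonneg) (fun n => dist_triangle_left _ _ (x (n + 1)))
      (by simpa using hxx.add hx)
  obtain ⟨⟨u, v⟩, hc, hw⟩ := exists_weaklyConverges_fixedPoint hR
    (z := fun n => pair (x n) (y n)) (by simpa [R, pair] using tendsto_dist_pair hxP hy)
    (by
      obtain ⟨u, v, h⟩ := hmin
      exact ⟨pair u v, congrArg₂ pair (h.left_eq hP) (h.right_eq hQ)⟩)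
    (by
      rintro ⟨u, v⟩ h
      obtain ⟨⟨l, hl⟩, l', hl'⟩ := hdist u v (hfix u v h)
      exact ⟨_, tendsto_dist_pair hl hl'⟩)
  exact ⟨u, v, hfix u v hc, hw⟩

end WeakConvergence

/-! ### From extended-real to real-valued functions -/

section ExtendedReal

variable {X : Type*}

/-- The effective domain of an extended-real-valued function. -/
def effDom (f : X → EReal) : Set X := {x | f x ≠ ⊤}

/-- The real-valued function `2γf`, meaningful on the effective domain of `f`. -/
noncomputable def scaledReal (γ : ℝ) (f : X → EReal) (x : X) : ℝ := 2 * γ * (f x).toReal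

variable {f g : X → EReal} {γ : ℝ}

theorem IsProper.coe_toReal (hf : IsProper f) {x : X} (hx : x ∈ effDom f) :
    ((f x).toReal : EReal) = f x :=
  EReal.coe_toReal hx (hf.2 x)

variable [MetricSpace X]

theorem IsConvex.isMidConvexOn (hγ : 0 < γ) (hf : IsProper f) (hconv : IsConvex f) :
    IsMidConvexOn (effDom f) (scaledReal γ f) := by
  intro x hx y hy m hm
  have h := hconv x y (1 / 2) ⟨by norm_num, by norm_num⟩ m hm
  rw [← hf.coe_toReal hx, ← hf.coe_toReal hy] at h
  have hmD : m ∈ effDom f := fun htop => by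
    rw [htop, ← EReal.coe_mul, ← EReal.coe_mul, ← EReal.coe_add, top_le_iff] at h
    exact EReal.coe_ne_top _ h
  refine ⟨hmD, ?_⟩
  rw [← hf.coe_toReal hmD] at h
  norm_cast at h
  have := mul_le_mul_of_nonneg_left h (by positivity : 0 ≤ 2 * γ)
  simp only [scaledReal]
  linarith

theorem IsUniformlyConvex.isUniformlyMidConvexOn (hγ : 0 < γ) (hf : IsProper f)
    (hconv : IsUniformlyConvex f) : IsUniformlyMidConvexOn (effDom f) (scaledReal γ f) := by
  obtain ⟨φ, hmono, hzero, hconv⟩ := hconv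
  intro δ hδ
  lift δ to ℝ≥0 using hδ.le
  -- The modulus may be infinite; truncating at 1 yields a real gap.
  have hne : min (φ δ) 1 ≠ ⊤ := ne_top_of_le_ne_top ENNReal.one_ne_top (min_le_right _ _)
  have hpos : min (φ δ) 1 ≠ 0 := by
    have : φ δ ≠ 0 := fun h => hδ.ne' (by simpa using (hzero δ).1 h)
    simpa using this
  have hr : 0 < (min (φ δ) 1).toReal := ENNReal.toReal_pos hpos hne
  refine ⟨2 * γ * (1 / 4 * (min (φ δ) 1).toReal), by positivity, fun x hx y hy m hm hd => ?_⟩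
  have h := hconv x y (1 / 2) ⟨by norm_num, by norm_num⟩ m hm
  have hle : (((min (φ δ) 1).toReal : ℝ) : EReal) ≤ ((φ (nndist x y) : ℝ≥0∞) : EReal) := by
    rw [EReal.coe_ennreal_toReal hne, EReal.coe_ennreal_le_coe_ennreal_iff]
    exact (min_le_left _ _).trans (hmono (by exact_mod_cast hd))
  have h4 : (0 : EReal) ≤ ((1 / 2 * (1 - 1 / 2) : ℝ) : EReal) := by
    exact_mod_cast (by norm_num : (0 : ℝ) ≤ 1 / 2 * (1 - 1 / 2))
  have h := (add_le_add_right (mul_le_mul_of_nonneg_left hle h4) (f m)).trans h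
  rw [← hf.coe_toReal hx, ← hf.coe_toReal hy] at h
  have hmD : f m ≠ ⊤ := fun htop => by
    rw [htop, ← EReal.coe_mul, ← EReal.coe_mul, ← EReal.coe_mul, ← EReal.coe_add,
      EReal.top_add_coe, top_le_iff] at h
    exact EReal.coe_ne_top _ h
  rw [← hf.coe_toReal hmD] at h
  norm_cast at h
  have := mul_le_mul_of_nonneg_left h (by positivity : 0 ≤ 2 * γ)
  simp only [scaledReal]
  linarith

/-- This is a preimage of the closed epigraph. A variable bound r is needed because prox objectives
add d(x,·)² to F. -/
theorem isClosed_scaledReal_le (hγ : 0 < γ) (hf : IsProper f) (hlsc : LowerSemicontinuous f)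
    {r : X → ℝ} (hr : Continuous r) :
    IsClosed {z | z ∈ effDom f ∧ scaledReal γ f z ≤ r z} := by
  have heq : {z | z ∈ effDom f ∧ scaledReal γ f z ≤ r z} =
      (fun z => (z, ((r z / (2 * γ) : ℝ) : EReal))) ⁻¹' {p : X × EReal | f p.1 ≤ p.2} := by
    ext z
    constructor
    · rintro ⟨hz, h⟩
      simp only [Set.mem_preimage, Set.mem_ofPred_eq]
      rw [← hf.coe_toReal hz, EReal.coe_le_coe_iff, le_div_iff₀' (by positivity)]
      exact h
    · intro h
      simp only [Set.mem_preimage, Set.mem_ofPred_eq] at h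
      have hz : z ∈ effDom f := ne_top_of_le_ne_top (EReal.coe_ne_top _) h
      rw [← hf.coe_toReal hz, EReal.coe_le_coe_iff, le_div_iff₀' (by positivity)] at h
      exact ⟨hz, h⟩
  rw [heq]
  exact hlsc.isClosed_epigraph.preimage
    (continuous_id.prodMk (continuous_coe_real_ereal.comp (hr.div_const _)))

theorem isProx_iff (hγ : 0 < γ) (hf : IsProper f) {x p : X} :
    IsProx (fun z => (γ : EReal) * f z) x p ↔ p ∈ effDom f ∧ ∀ z ∈ effDom f,
      scaledReal γ f p + dist x p ^ 2 ≤ scaledReal γ f z + dist x z ^ 2 := by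
  have htop : (γ : EReal) * ⊤ = ⊤ := EReal.coe_mul_top_of_pos hγ
  have hreal : ∀ z ∈ effDom f, (γ : EReal) * f z + ((1 / 2 * dist x z ^ 2 : ℝ) : EReal) =
      ((1 / 2 * (scaledReal γ f z + dist x z ^ 2) : ℝ) : EReal) := fun z hz => by
    rw [← hf.coe_toReal hz, ← EReal.coe_mul, ← EReal.coe_add, EReal.coe_eq_coe_iff, scaledReal]
    ring
  constructor
  · intro h
    have hp : p ∈ effDom f := fun hp => by
      obtain ⟨z, hz⟩ := hf.1
      have h1 := h z
      simp only at h1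
      rw [hreal z hz, hp, htop, EReal.top_add_coe, top_le_iff] at h1
      exact EReal.coe_ne_top _ h1
    refine ⟨hp, fun z hz => ?_⟩
    have h1 := h z
    simp only at h1
    rw [hreal z hz, hreal p hp, EReal.coe_le_coe_iff] at h1
    linarith
  · rintro ⟨hp, h⟩ z
    by_cases hz : z ∈ effDom f
    · simp only
      rw [hreal z hz, hreal p hp, EReal.coe_le_coe_iff]
      linarith [h z hz]
    · have hz' : f z = ⊤ := not_not.1 hz
      simp only
      rw [hz', htop, EReal.top_add_coe]
      exact le_top

theorem isProxMap_proxScaled [HadamardSpace X] (hγ : 0 < γ) (hf : IsProper f)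
    (hconv : IsConvex f) (hlsc : LowerSemicontinuous f) {a : X} {C : ℝ}
    (hbdd : ∀ z ∈ effDom f, C ≤ scaledReal γ f z + dist a z ^ 2) :
    IsProxMap (effDom f) (scaledReal γ f) (proxScaled γ f) := by
  have key : ∀ x, proxScaled γ f x ∈ effDom f ∧ ∀ z ∈ effDom f,
      scaledReal γ f (proxScaled γ f x) + dist x (proxScaled γ f x) ^ 2 +
        dist (proxScaled γ f x) z ^ 2 ≤ scaledReal γ f z + dist x z ^ 2 := fun x => by
    obtain ⟨p, hpD, hp⟩ := exists_prox hf.1 (hconv.isMidConvexOn hγ hf)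
      (fun r hr => isClosed_scaledReal_le hγ hf hlsc hr) hbdd x
    have hex : ∃ p, IsProx (fun z => (γ : EReal) * f z) x p :=
      ⟨p, (isProx_iff hγ hf).2 ⟨hpD, fun z hz => by linarith [hp z hz, sq_nonneg (dist p z)]⟩⟩
    have heq : proxScaled γ f x = p := by
      rw [proxScaled, prox, dif_pos hex]
      obtain ⟨hcD, hc⟩ := (isProx_iff hγ hf).1 hex.choose_spec
      -- Quadratic growth at p identifies the arbitrarily chosen minimizer with p.
      have h3 : dist p hex.choose ^ 2 = 0 :=
        le_antisymm (by linarith [hp _ hcD, hc p hpD]) (sq_nonneg _)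
      exact (dist_eq_zero.1 (pow_eq_zero_iff two_ne_zero |>.1 h3)).symm
    rw [heq]
    exact ⟨hpD, hp⟩
  exact ⟨fun x => (key x).1, fun x => (key x).2⟩

theorem Phi_eq_coe (hγ : 0 < γ) (hf : IsProper f) (hg : IsProper g) {u v : X}
    (hu : u ∈ effDom f) (hv : v ∈ effDom g) :
    Phi γ f g u v =
      ((1 / (2 * γ) * coupled (scaledReal γ f) (scaledReal γ g) u v : ℝ) : EReal) := by
  rw [Phi, ← hf.coe_toReal hu, ← hg.coe_toReal hv, ← EReal.coe_add, ← EReal.coe_add,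
    EReal.coe_eq_coe_iff, coupled, scaledReal, scaledReal]
  field_simp

theorem Phi_eq_top (hf : IsProper f) (hg : IsProper g) {u v : X}
    (h : ¬(u ∈ effDom f ∧ v ∈ effDom g)) : Phi γ f g u v = ⊤ := by
  by_cases hu : u ∈ effDom f
  · have hv : g v = ⊤ := not_not.1 fun hv => h ⟨hu, hv⟩
    rw [Phi, hv, EReal.add_top_of_ne_bot (hf.2 u), EReal.top_add_coe]
  · have hu : f u = ⊤ := not_not.1 hu
    rw [Phi, hu, EReal.top_add_of_ne_bot (hg.2 v), EReal.top_add_coe]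

theorem isSolution_iff (hγ : 0 < γ) (hf : IsProper f) (hg : IsProper g) {u v : X} :
    IsSolution γ f g u v ↔
      IsCoupledMin (effDom f) (effDom g) (scaledReal γ f) (scaledReal γ g) u v := by
  have hγ' : 0 < 1 / (2 * γ) := by positivity
  constructor
  · intro h
    have huv : u ∈ effDom f ∧ v ∈ effDom g := by
      by_contra huv
      obtain ⟨a, ha⟩ := hf.1
      obtain ⟨b, hb⟩ := hg.1
      have h1 := h a b
      rw [Phi_eq_top hf hg huv, Phi_eq_coe hγ hf hg ha hb, top_le_iff] at h1
      exact EReal.coe_ne_top _ h1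
    refine ⟨huv.1, huv.2, fun w hw z hz => ?_⟩
    have h1 := h w z
    rw [Phi_eq_coe hγ hf hg huv.1 huv.2, Phi_eq_coe hγ hf hg hw hz, EReal.coe_le_coe_iff] at h1
    exact le_of_mul_le_mul_left h1 hγ'
  · intro h w z
    by_cases hwz : w ∈ effDom f ∧ z ∈ effDom g
    · rw [Phi_eq_coe hγ hf hg h.left_mem h.right_mem, Phi_eq_coe hγ hf hg hwz.1 hwz.2,
        EReal.coe_le_coe_iff]
      exact mul_le_mul_of_nonneg_left (h.le w hwz.1 z hwz.2) hγ'.le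
    · rw [Phi_eq_top hf hg hwz]
      exact le_top

theorem IsSolution.iInf_eq {u v : X} (h : IsSolution γ f g u v) :
    ⨅ u : X, ⨅ v : X, Phi γ f g u v = Phi γ f g u v :=
  le_antisymm ((iInf_le _ u).trans (iInf_le _ v)) (le_iInf₂ h)

end ExtendedReal

end Hadamard

/-! ### Assembly of the theorem -/

open Hadamard in
theorem mainTheorem1 {X : Type*} [MetricSpace X] [Hadamard.HadamardSpace X]
    (f g : X → EReal)
    (hf_proper : Hadamard.IsProper f) (hf_convex : Hadamard.IsConvex f)
    (hf_lsc : LowerSemicontinuous f)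
    (hg_proper : Hadamard.IsProper g) (hg_convex : Hadamard.IsConvex g)
    (hg_lsc : LowerSemicontinuous g)
    (γ : ℝ) (hγ : 0 < γ)
    (hbdd : ∃ c : ℝ, ∀ u v : X, (c : EReal) ≤ Hadamard.Phi γ f g u v)
    (x y : ℕ → X)
    (hy : Summable fun n => dist (y n) (Hadamard.proxScaled γ g (x n)))
    (hx : Summable fun n => dist (x (n + 1)) (Hadamard.proxScaled γ f (y n))) :
    ((Summable fun n => dist (x (n + 1)) (x n) ^ 2) ∧
      (Summable fun n => dist (y (n + 1)) (y n) ^ 2)) ∧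
    ((∃ u v : X, Hadamard.IsSolution γ f g u v) →
      (Tendsto (fun n => Hadamard.Phi γ f g
          (Hadamard.proxScaled γ f (Hadamard.proxScaled γ g (x n)))
          (Hadamard.proxScaled γ g (x n))) atTop
          (𝓝 (⨅ u : X, ⨅ v : X, Hadamard.Phi γ f g u v)) ∧
        Tendsto (fun n => Hadamard.Phi γ f g
          (Hadamard.proxScaled γ f (y n))
          (Hadamard.proxScaled γ g (Hadamard.proxScaled γ f (y n)))) atTop
          (𝓝 (⨅ u : X, ⨅ v : X, Hadamard.Phi γ f g u v))) ∧
      (∃ u v : X, Hadamard.IsSolution γ f g u v ∧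
        Hadamard.WeaklyConverges (fun n => Hadamard.pair (x n) (y n)) (Hadamard.pair u v)) ∧
      (Hadamard.IsUniformlyConvex f ∨ Hadamard.IsUniformlyConvex g →
        ∃ u v : X, Hadamard.IsSolution γ f g u v ∧
          (∀ u' v' : X, Hadamard.IsSolution γ f g u' v' → u' = u ∧ v' = v) ∧
          Tendsto (fun n => Hadamard.pair (x n) (y n)) atTop (𝓝 (Hadamard.pair u v)))) := by
  have hFconv := hf_convex.isMidConvexOn hγ hf_proper
  have hGconv := hg_convex.isMidConvexOn hγ hg_proper
  obtain ⟨c, hc⟩ := hbdd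
  have hJ : ∀ u ∈ effDom f, ∀ v ∈ effDom g,
      2 * γ * c ≤ coupled (scaledReal γ f) (scaledReal γ g) u v := fun u hu v hv => by
    have h := hc u v
    rw [Phi_eq_coe hγ hf_proper hg_proper hu hv, EReal.coe_le_coe_iff, one_div,
      inv_mul_eq_div, le_div_iff₀' (by positivity)] at h
    exact h
  obtain ⟨a, ha⟩ := hf_proper.1
  obtain ⟨b, hb⟩ := hg_proper.1
  -- Freezing the second variable at b bounds the prox objective of f centred at b, which is enough
  -- for all centres.
  have hP : IsProxMap (effDom f) (scaledReal γ f) (proxScaled γ f) :=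
    isProxMap_proxScaled hγ hf_proper hf_convex hf_lsc (a := b)
      (C := 2 * γ * c - scaledReal γ g b) fun z hz => by
        have h := hJ z hz b hb
        rw [coupled, dist_comm] at h
        linarith
  have hQ : IsProxMap (effDom g) (scaledReal γ g) (proxScaled γ g) :=
    isProxMap_proxScaled hγ hg_proper hg_convex hg_lsc (a := a)
      (C := 2 * γ * c - scaledReal γ f a) fun z hz => by
        have h := hJ a ha z hz
        rw [coupled] at h
        linarith
  have hx' : Summable fun n => dist (x (n + 1)) (proxScaled γ f (proxScaled γ g (x n))) :=
    hP.summable_dist_comp hx hy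
  have hy' : Summable fun n => dist (y (n + 1)) (proxScaled γ g (proxScaled γ f (y n))) :=
    hQ.summable_dist_comp ((summable_nat_add_iff 1).2 hy) hx
  have hxx := hP.summable_dist_sq hQ hJ hx'
  have hyy := hQ.summable_dist_sq hP
    (fun u hu v hv => (hJ v hv u hu).trans_eq (coupled_swap _ _ _ _)) hy'
  refine ⟨⟨hxx, hyy⟩, ?_⟩
  rintro ⟨u, v, hsol⟩
  have hmin := (isSolution_iff hγ hf_proper hg_proper).1 hsol
  refine ⟨?_, ?_, ?_⟩
  · have hlim : ∀ p q : ℕ → X, (∀ n, p n ∈ effDom f) → (∀ n, q n ∈ effDom g) →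
        Tendsto (fun n => coupled (scaledReal γ f) (scaledReal γ g) (p n) (q n)) atTop
          (𝓝 (coupled (scaledReal γ f) (scaledReal γ g) u v)) →
        Tendsto (fun n => Phi γ f g (p n) (q n)) atTop
          (𝓝 (⨅ u : X, ⨅ v : X, Phi γ f g u v)) := by
      intro p q hp hq h
      rw [hsol.iInf_eq, Phi_eq_coe hγ hf_proper hg_proper hmin.left_mem hmin.right_mem]
      simp only [Phi_eq_coe hγ hf_proper hg_proper (hp _) (hq _)]
      exact (continuous_coe_real_ereal.tendsto _).comp (h.const_mul _)
    refine ⟨hlim _ _ (fun n => hP.mem _) (fun n => hQ.mem _) (hmin.tendsto_coupled hP hQ hx'),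
      hlim _ _ (fun n => hP.mem _) (fun n => hQ.mem _) ?_⟩
    rw [coupled_swap]
    simp only [coupled_swap (scaledReal γ f)]
    exact hmin.swap.tendsto_coupled hQ hP hy'
  · obtain ⟨u', v', h, hw⟩ := hP.exists_weaklyConverges hQ ⟨u, v, hmin⟩ hy.tendsto_atTop_zero
      hx.tendsto_atTop_zero (tendsto_dist_zero_of_summable_sq hxx) fun u v h =>
        ⟨h.exists_tendsto_dist hP hQ hx', h.swap.exists_tendsto_dist hQ hP hy'⟩
    exact ⟨u', v', (isSolution_iff hγ hf_proper hg_proper).2 h, hw⟩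
  · intro hunif
    refine ⟨u, v, hsol, ?_⟩
    rcases hunif with hunif | hunif
    · have hFu := hunif.isUniformlyMidConvexOn hγ hf_proper
      refine ⟨fun u' v' h' => ?_, ?_⟩
      · have h := (isSolution_iff hγ hf_proper hg_proper).1 h'
        have hu := hmin.left_unique hFconv hFu hGconv h
        exact ⟨hu, by rw [← h.right_eq hQ, hu, hmin.right_eq hQ]⟩
      · have hxu := hmin.tendsto_of_uniformlyMidConvexOn hP hQ hFconv hFu hGconv hx'
        exact tendsto_pair hxu (hmin.right_eq hQ ▸
          hQ.tendsto_of_tendsto_dist hxu hy.tendsto_atTop_zero)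
    · have hGu := hunif.isUniformlyMidConvexOn hγ hg_proper
      refine ⟨fun u' v' h' => ?_, ?_⟩
      · have h := (isSolution_iff hγ hf_proper hg_proper).1 h'
        have hv := hmin.swap.left_unique hGconv hGu hFconv h.swap
        exact ⟨by rw [← h.left_eq hP, hv, hmin.left_eq hP], hv⟩
      · have hyv := hmin.swap.tendsto_of_uniformlyMidConvexOn hQ hP hGconv hGu hFconv hy'
        -- P(y_n) approximates x_{n+1}, so the limit is first obtained for the shifted sequence.
        have hxu := hP.tendsto_of_tendsto_dist (x := y) (y := fun n => x (n + 1)) hyv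
          hx.tendsto_atTop_zero
        rw [hmin.left_eq hP] at hxu
        exact tendsto_pair ((tendsto_add_atTop_iff_nat 1).1 hxu) hyv
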